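/- Let $X$ be a compact connected (Hausdorff) complex manifold of dimension $k$. A holomorphic correspondence on $X$ is a formal sum $\Gamma=\sum_{j=1}^N m_j\Gamma_j$ with $N\ge 1$, positive integers $m_j$ and distinct irreducible complex subvarieties $\Gamma_j\subset X\times X$ of dimension $k$, such that both coordinate projections $\pi_1,\pi_2:\Gamma_j\to X$ are surjective for each $j$ and, for every $z\in X$, the sets $\bigcup_j\pi_2(\pi_1^{-1}\{z\}\cap\Gamma_j)$ and $F^\dagger(z)=\bigcup_j\pi_1(\pi_2^{-1}\{z\}\cap\Gamma_j)$ are finite; $F$ denotes the set-valued map $z\mapsto\bigcup_j\pi_2(\pi_1^{-1}\{z\}\cap\Gamma_j)$ that it induces. For $\phi:X\to\mathbb R$ write $$\sideset{}{'}\sum_{w\in F^\dagger(z)}\phi(w)=\sum_{j=1}^N m_j\sum_{w:\,(w,z)\in\Gamma_j}\nu_j(w,z)\,\phi(w),$$ where $\nu_j(w,z)$ is the local degree of $\pi_2|_{\Gamma_j}$ at $(w,z)$, i.e. the number of points of $\Gamma_j$ close to $(w,z)$ that lie over a generic point close to $z$. Let $d$ be the topological degree of $F$, i.e. the number $\sum_j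 m_j\,\#\{w:(w,z)\in\Gamma_j\}$ for generic $z\in X$. Let $\mu$ be a Borel probability measure on $X$ that is $F^*$-invariant: $$\int_X\ \sideset{}{'}\sum_{w\in F^\dagger(z)}\phi(w)\,d\mu(z)=d\int_X\phi\,d\mu\quad\text{for all }\phi\in\mathcal C(X,\mathbb R).$$ Put $(U_F\phi)(z)=\frac1d\sum'_{w\in F^\dagger(z)}\phi(w)$, $I(\phi)=\int_X\phi\,d\mu$ and $I_n^F(\phi,\psi)=\int_X (U_F^n\phi)\,\psi\,d\mu$ for $n\ge 0$. Call $F$ mixing (resp. weakly mixing) with respect to $\mu$ if $$\lim_{n\to\infty}I_n^F(\phi,\psi)=I(\phi)I(\psi)\qquad\Bigl(\text{resp. }\lim_{n\to\infty}\frac1n\sum_{j=0}^{n-1}\bigl|I_j^F(\phi,\psi)-I(\phi)I(\psi)\bigr|=0\Bigr)$$ for all $\phi\in\mathcal C(X,\mathbb R)$ and all real-valued $\psi\in L^1(\mu)$. Then $F$ is mixing (resp. weakly mixing) with respect to $\mu$ if and only if, for all real-valued $\phi,\psi\in L^2(\mu)$, $$\lim_{n\to\infty}I_n^F(\phi,\psi)=I(\phi)I(\psi)\qquad\Bigl(\text{resp.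 }\lim_{n\to\infty}\frac1n\sum_{j=0}^{n-1}\bigl|I_j^F(\phi,\psi)-I(\phi)I(\psi)\bigr|=0\Bigr).$$ -/

import Mathlib

open MeasureTheory Filter Topology
open scoped Manifold ContDiff

noncomputable section

section Analytic

/-- A (closed) complex analytic subset, or complex subvariety, of a complex manifold `M`:
near every point of `M` it is the common zero set of finitely many holomorphic functions. -/
def IsAnalyticSubset {E H M : Type*} [NormedAddCommGroup E] [NormedSpace ℂ E]
    [TopologicalSpace H] (I : ModelWithCorners ℂ E H) [TopologicalSpace M] [ChartedSpace H M]
    (Z : Set M) : Prop :=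
  ∀ p : M, ∃ U : Set M, IsOpen U ∧ p ∈ U ∧ ∃ (n : ℕ) (f : Fin n → M → ℂ),
    (∀ i, MDifferentiableOn I 𝓘(ℂ, ℂ) (f i) U) ∧ ∀ q ∈ U, (q ∈ Z ↔ ∀ i, f i q = 0)

/-- An irreducible complex subvariety: a nonempty analytic subset which is not the union of two
analytic subsets that are both different from it. -/
def IsIrreducibleAnalytic {E H M : Type*} [NormedAddCommGroup E] [NormedSpace ℂ E]
    [TopologicalSpace H] (I : ModelWithCorners ℂ E H) [TopologicalSpace M] [ChartedSpace H M]
    (Z : Set M) : Prop :=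
  IsAnalyticSubset I Z ∧ Z.Nonempty ∧
    ∀ A B : Set M, IsAnalyticSubset I A → IsAnalyticSubset I B → Z = A ∪ B → Z = A ∨ Z = B

/-- `p` is a regular point of `Z` at which `Z` has dimension `d`: in some holomorphic chart around
`p`, the set `Z` is a `d`-dimensional complex affine subspace. -/
def IsRegularPointOfDim {E H M : Type*} [NormedAddCommGroup E] [NormedSpace ℂ E]
    [TopologicalSpace H] (I : ModelWithCorners ℂ E H) [TopologicalSpace M] [ChartedSpace H M]
    (Z : Set M) (d : ℕ) (p : M) : Prop :=
  p ∈ Z ∧ ∃ e ∈ IsManifold.maximalAtlas I ω M, p ∈ e.source ∧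
    ∃ W : Submodule ℂ E, Module.finrank ℂ W = d ∧
      ∀ q ∈ e.source, (q ∈ Z ↔ I (e q) - I (e p) ∈ W)

/-- `Z` has (pure) dimension `d`: the regular points of dimension `d` are dense in `Z`. For an
irreducible analytic set this says that its dimension is `d`. -/
def HasAnalyticDim {E H M : Type*} [NormedAddCommGroup E] [NormedSpace ℂ E]
    [TopologicalSpace H] (I : ModelWithCorners ℂ E H) [TopologicalSpace M] [ChartedSpace H M]
    (Z : Set M) (d : ℕ) : Prop :=
  Z ⊆ closure {p | IsRegularPointOfDim I Z d p}

end Analytic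

/-- The complex vector space on which complex manifolds of dimension `k` are modelled. -/
abbrev CModel (k : ℕ) : Type := EuclideanSpace ℂ (Fin k)

/-- A holomorphic correspondence `∑ j, m j • Γ j` on a complex manifold `X` of dimension `k`. -/
structure HolomorphicCorrespondence (k : ℕ) (X : Type*) [TopologicalSpace X]
    [ChartedSpace (CModel k) X] where
  /-- the number of components -/
  N : ℕ
  N_pos : 0 < N
  /-- the multiplicities -/
  m : Fin N → ℕ
  m_pos : ∀ j, 0 < m j
  /-- the components -/
  Γ : Fin N → Set (X × X)
  Γ_injective : Function.Injective Γ
  irreducible : ∀ j, IsIrreducibleAnalytic (𝓘(ℂ, CModel k).prod 𝓘(ℂ, CModel k)) (Γ j)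
  dim_eq : ∀ j, HasAnalyticDim (𝓘(ℂ, CModel k).prod 𝓘(ℂ, CModel k)) (Γ j) k
  fst_surj : ∀ j, Prod.fst '' Γ j = Set.univ
  snd_surj : ∀ j, Prod.snd '' Γ j = Set.univ
  finite_image : ∀ z, (⋃ j, Prod.snd '' (Prod.fst ⁻¹' {z} ∩ Γ j)).Finite
  finite_preimage : ∀ z, (⋃ j, Prod.fst '' (Prod.snd ⁻¹' {z} ∩ Γ j)).Finite

/-- The multiplicity (local degree) at `(w, z)` of the projection `(w', z') ↦ z'` restricted to
`Z ⊆ X × X`: the number `n` such that, for every sufficiently small neighbourhood `U` of `w`, a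
generic point `z'` close to `z` has exactly `n` preimages `(w', z') ∈ Z` with `w' ∈ U`. At most one
`n` has this property, since two dense open sets have a dense intersection. -/
def localDegree {X : Type*} [TopologicalSpace X] (Z : Set (X × X)) (w z : X) : ℕ :=
  sInf {n : ℕ | ∃ U₀ ∈ 𝓝 w, ∀ U ∈ 𝓝 w, U ⊆ U₀ →
    ∃ V ∈ 𝓝 z, ∃ G : Set X, IsOpen G ∧ Dense G ∧
      ∀ z' ∈ V ∩ G, {w' ∈ U | (w', z') ∈ Z}.ncard = n}

namespace HolomorphicCorrespondence

variable {k : ℕ} {X : Type*} [TopologicalSpace X] [ChartedSpace (CModel k) X]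

/-- The topological degree: the number of points, with the multiplicities `m j` of the components,
of the preimage of a generic point. -/
def topDegree (F : HolomorphicCorrespondence k X) : ℕ :=
  sInf {n : ℕ | ∃ G : Set X, IsOpen G ∧ Dense G ∧
    ∀ z ∈ G, ∑ j, F.m j * {w | (w, z) ∈ F.Γ j}.ncard = n}

/-- The sum of `φ w` over all preimages `w` of `z`, repeated according to multiplicity. -/
def preimageSum (F : HolomorphicCorrespondence k X) (φ : X → ℝ) (z : X) : ℝ :=
  ∑ j, (F.m j : ℝ) * ∑ᶠ w ∈ {w | (w, z) ∈ F.Γ j}, (localDegree (F.Γ j) w z : ℝ) * φ w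

/-- The Koopman operator `U_F`. -/
def koopman (F : HolomorphicCorrespondence k X) (φ : X → ℝ) (z : X) : ℝ :=
  (1 / (F.topDegree : ℝ)) * F.preimageSum φ z

variable [MeasurableSpace X]

/-- `F^* μ = d μ`, both sides being tested against continuous functions. -/
def IsPullbackInvariant (F : HolomorphicCorrespondence k X) (μ : Measure X) : Prop :=
  ∀ φ : C(X, ℝ), ∫ z, F.preimageSum φ z ∂μ = (F.topDegree : ℝ) * ∫ z, φ z ∂μ

/-- `I_n^F(φ, ψ) = ∫ (U_F^n φ) ψ dμ`. -/
def correlation (F : HolomorphicCorrespondence k X) (μ : Measure X) (n : ℕ) (φ ψ : X → ℝ) : ℝ :=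
  ∫ z, (F.koopman^[n] φ) z * ψ z ∂μ

/-- `F` is mixing with respect to `μ`. -/
def IsMixing (F : HolomorphicCorrespondence k X) (μ : Measure X) : Prop :=
  ∀ (φ : C(X, ℝ)) (ψ : X → ℝ), Integrable ψ μ →
    Tendsto (fun n : ℕ => F.correlation μ n φ ψ) atTop (𝓝 ((∫ z, φ z ∂μ) * ∫ z, ψ z ∂μ))

/-- `F` is weakly mixing with respect to `μ`. -/
def IsWeaklyMixing (F : HolomorphicCorrespondence k X) (μ : Measure X) : Prop :=
  ∀ (φ : C(X, ℝ)) (ψ : X → ℝ), Integrable ψ μ →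
    Tendsto (fun n : ℕ => (1 / (n : ℝ)) * ∑ j ∈ Finset.range n,
      |F.correlation μ j φ ψ - (∫ z, φ z ∂μ) * ∫ z, ψ z ∂μ|) atTop (𝓝 0)

end HolomorphicCorrespondence

end

/-! `U_F` is integration against a family of measures `κ z`, the normalized sum of point masses over
the preimages of `z`. Local degrees over `z` add up to at most the number of preimages of a generic
nearby point, so `κ z` has mass at most one (`preimageMeasure_univ_le_one`) and `U_F` does not
increase sup bounds. Invariance of `μ`, given on continuous functions, extends to Borel sets and
then to measurable functions; with Cauchy–Schwarz on each `κ z` this makes `U_F` a contraction of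
`L²(μ)` (`memLp_iterate_koopman`).

Hence the deviation of `I_n(φ, ψ)` from `I(φ) I(ψ)` is Lipschitz in each argument, uniformly in `n`:
in `φ` for the `L²` norm when `ψ` is in `L²`, and in `ψ` for the `L¹` norm when `φ` is bounded. One
direction approximates `φ` by continuous functions in `L²`, the other approximates `ψ` by bounded
continuous functions in `L¹`. Both modes of convergence survive uniform approximation, so one
argument serves for both. -/

open scoped ENNReal NNReal

/-! ### Local degrees and generic fibres -/

section Generic

variable {X : Type*} [TopologicalSpace X]

/-- `P` holds at all points close to `z` that lie in some dense open set. -/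
def GenericallyNear (z : X) (P : X → Prop) : Prop :=
  ∃ V ∈ 𝓝 z, ∃ G : Set X, IsOpen G ∧ Dense G ∧ ∀ z' ∈ V ∩ G, P z'

theorem GenericallyNear.and {z : X} {P Q : X → Prop} (hP : GenericallyNear z P)
    (hQ : GenericallyNear z Q) : GenericallyNear z fun z' => P z' ∧ Q z' := by
  obtain ⟨V, hV, G, hGo, hGd, h⟩ := hP
  obtain ⟨V', hV', G', hGo', hGd', h'⟩ := hQ
  exact ⟨V ∩ V', inter_mem hV hV', G ∩ G', hGo.inter hGo', hGd.inter_of_isOpen_left hGd' hGo,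
    fun z' hz' => ⟨h z' ⟨hz'.1.1, hz'.2.1⟩, h' z' ⟨hz'.1.2, hz'.2.2⟩⟩⟩

theorem GenericallyNear.mono {z : X} {P Q : X → Prop} (hP : GenericallyNear z P)
    (h : ∀ z', P z' → Q z') : GenericallyNear z Q := by
  obtain ⟨V, hV, G, hGo, hGd, hG⟩ := hP
  exact ⟨V, hV, G, hGo, hGd, fun z' hz' => h z' (hG z' hz')⟩

theorem genericallyNear_of_forall {z : X} {P : X → Prop} (h : ∀ z', P z') :
    GenericallyNear z P :=
  ⟨Set.univ, univ_mem, Set.univ, isOpen_univ, dense_univ, fun z' _ => h z'⟩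

theorem genericallyNear_forall_finset {ι : Type*} {z : X} {P : ι → X → Prop} (T : Finset ι)
    (h : ∀ i ∈ T, GenericallyNear z (P i)) : GenericallyNear z fun z' => ∀ i ∈ T, P i z' := by
  classical
  induction T using Finset.induction_on with
  | empty => exact genericallyNear_of_forall (by simp)
  | insert a s ha ih =>
    refine ((h a (Finset.mem_insert_self a s)).and
      (ih fun i hi => h i (Finset.mem_insert_of_mem hi))).mono fun z' hz' => ?_
    simpa using hz'

theorem GenericallyNear.exists {z : X} {P : X → Prop} (h : GenericallyNear z P) : ∃ z', P z' := by
  obtain ⟨V, hV, G, -, hGd, hG⟩ := h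
  obtain ⟨z', hz'⟩ := hGd.inter_nhds_nonempty hV
  exact ⟨z', hG z' ⟨hz'.2, hz'.1⟩⟩

theorem exists_nhds_genericallyNear_localDegree_le (Z : Set (X × X)) (w z : X) :
    ∃ U₀ ∈ 𝓝 w, ∀ U ∈ 𝓝 w, U ⊆ U₀ →
      GenericallyNear z fun z' => localDegree Z w z ≤ {w' ∈ U | (w', z') ∈ Z}.ncard := by
  -- The infimum of an empty set is `0`, for which the bound is trivial; a positive value is
  -- attained.
  rcases Nat.eq_zero_or_pos (localDegree Z w z) with h | h
  · exact ⟨Set.univ, univ_mem, fun U _ _ => genericallyNear_of_forall (by simp [h])⟩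
  · obtain ⟨U₀, hU₀, hU⟩ := Nat.sInf_mem (Nat.nonempty_of_pos_sInf h)
    refine ⟨U₀, hU₀, fun U hUw hUU => ?_⟩
    obtain ⟨V, hV, G, hGo, hGd, hG⟩ := hU U hUw hUU
    exact ⟨V, hV, G, hGo, hGd, fun z' hz' => (hG z' hz').ge⟩

/-- The local degrees over `z` add up to at most the number of points over a generic point close
to `z`. -/
theorem genericallyNear_sum_localDegree_le [T2Space X] {Z : Set (X × X)}
    (hZ : ∀ z, {w | (w, z) ∈ Z}.Finite) (T : Finset X) (z : X) :
    GenericallyNear z fun z' => ∑ w ∈ T, localDegree Z w z ≤ {w | (w, z') ∈ Z}.ncard := by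
  classical
  choose U₀ hU₀ hU using fun w => exists_nhds_genericallyNear_localDegree_le Z w z
  -- Disjoint neighbourhoods of the points of `T` keep any nearby preimage from being counted twice.
  obtain ⟨D, hD, hdisj⟩ := T.finite_toSet.t2_separation
  refine (genericallyNear_forall_finset T fun w _ => hU w (U₀ w ∩ D w)
    (inter_mem (hU₀ w) ((hD w).2.mem_nhds (hD w).1)) Set.inter_subset_left).mono fun z' hz' => ?_
  refine (Finset.sum_le_sum hz').trans ?_
  have hfin : ∀ w, {w' ∈ U₀ w ∩ D w | (w', z') ∈ Z}.Finite := fun w =>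
    (hZ z').subset fun w' hw' => hw'.2
  simp_rw [Set.ncard_eq_toFinset_card _ (hfin _), Set.ncard_eq_toFinset_card _ (hZ z')]
  rw [← Finset.card_biUnion]
  · refine Finset.card_le_card fun w' hw' => ?_
    simp only [Finset.mem_biUnion, Set.Finite.mem_toFinset] at hw' ⊢
    obtain ⟨w, -, hw⟩ := hw'
    exact hw.2
  · intro a ha b hb hab
    refine Finset.disjoint_left.2 ?_
    intro x hxa hxb
    simp only [Set.Finite.mem_toFinset] at hxa hxb
    exact Set.disjoint_left.1 (hdisj ha hb hab) hxa.1.2 hxb.1.2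

end Generic

/-! ### Invariant families of subprobability measures -/

section Kernel

variable {X : Type*} [TopologicalSpace X] [TopologicalSpace.PseudoMetrizableSpace X]
  [MeasurableSpace X] [BorelSpace X]

/-- Invariance of `μ` under a family of subprobability measures can be tested on bounded
continuous functions instead of measurable sets. -/
theorem aemeasurable_and_lintegral_measure_eq {κ : X → Measure X} {μ : Measure X}
    [IsProbabilityMeasure μ] (hκ : ∀ z, κ z Set.univ ≤ 1)
    (h : ∀ g : BoundedContinuousFunction X ℝ≥0, AEMeasurable (fun z => ∫⁻ x, g x ∂κ z) μ ∧
      ∫⁻ z, ∫⁻ x, g x ∂κ z ∂μ = ∫⁻ x, g x ∂μ)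
    {A : Set X} (hA : MeasurableSet A) :
    AEMeasurable (fun z => κ z A) μ ∧ ∫⁻ z, κ z A ∂μ = μ A := by
  have hfin : ∀ z, IsFiniteMeasure (κ z) := fun z => ⟨(hκ z).trans_lt ENNReal.one_lt_top⟩
  have hle : ∀ z A, κ z A ≤ 1 := fun z A => (measure_mono (Set.subset_univ A)).trans (hκ z)
  have hclosed : ∀ A, IsClosed A →
      AEMeasurable (fun z => κ z A) μ ∧ ∫⁻ z, κ z A ∂μ = μ A := by
    intro A hA
    have ht : ∀ z, Tendsto (fun n => ∫⁻ x, hA.apprSeq n x ∂κ z) atTop (𝓝 (κ z A)) :=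
      fun z => HasOuterApproxClosed.tendsto_lintegral_apprSeq hA (κ z)
    refine ⟨aemeasurable_of_tendsto_metrizable_ae atTop (fun n => (h (hA.apprSeq n)).1)
      (ae_of_all _ ht), ?_⟩
    have h1 := tendsto_lintegral_of_dominated_convergence' (μ := μ) (fun _ => 1)
      (fun n => (h (hA.apprSeq n)).1)
      (fun n => ae_of_all _ fun z => ?_) (by simp) (ae_of_all _ ht)
    · simp_rw [fun n => (h (hA.apprSeq n)).2] at h1
      exact tendsto_nhds_unique h1 (HasOuterApproxClosed.tendsto_lintegral_apprSeq hA μ)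
    · refine le_trans (lintegral_mono (g := fun _ => 1) fun x => ?_) (by simpa using hκ z)
      exact ENNReal.coe_le_one_iff.2 (HasOuterApproxClosed.apprSeq_apply_le_one hA n x)
  -- The total masses need not be one, so complements require the case of the whole space.
  obtain ⟨hum, hui⟩ := hclosed Set.univ isClosed_univ
  induction A, hA using MeasurableSpace.induction_on_inter
    ((BorelSpace.measurable_eq (α := X)).trans borel_eq_generateFrom_isClosed)
    isPiSystem_isClosed with
  | empty => simp
  | basic A hA => exact hclosed A hA
  | compl A hA ih =>
    have heq : ∀ z, κ z Aᶜ = κ z Set.univ - κ z A := fun z =>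
      measure_compl hA (measure_ne_top _ _)
    simp_rw [heq]
    refine ⟨hum.sub ih.1, ?_⟩
    rw [lintegral_sub' ih.1 (by rw [ih.2]; exact measure_ne_top _ _)
      (ae_of_all _ fun z => measure_mono (Set.subset_univ A)), hui, ih.2,
      measure_compl hA (measure_ne_top _ _)]
  | iUnion f hd hm ih =>
    have heq : ∀ z, κ z (⋃ i, f i) = ∑' i, κ z (f i) := fun z => measure_iUnion hd hm
    simp_rw [heq]
    refine ⟨AEMeasurable.tsum fun i => (ih i).1, ?_⟩
    rw [lintegral_tsum fun i => (ih i).1, measure_iUnion hd hm]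
    exact tsum_congr fun i => (ih i).2

/-- Invariance on measurable sets passes to measurable functions. -/
theorem aemeasurable_and_lintegral_lintegral_eq {X : Type*} [MeasurableSpace X]
    {κ : X → Measure X} {μ : Measure X}
    (h : ∀ A, MeasurableSet A → AEMeasurable (fun z => κ z A) μ ∧ ∫⁻ z, κ z A ∂μ = μ A)
    {f : X → ℝ≥0∞} (hf : AEMeasurable f μ) :
    AEMeasurable (fun z => ∫⁻ x, f x ∂κ z) μ ∧ ∫⁻ z, ∫⁻ x, f x ∂κ z ∂μ = ∫⁻ x, f x ∂μ := by
  have hmeas : ∀ g : X → ℝ≥0∞, Measurable g → AEMeasurable (fun z => ∫⁻ x, g x ∂κ z) μ ∧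
      ∫⁻ z, ∫⁻ x, g x ∂κ z ∂μ = ∫⁻ x, g x ∂μ := by
    intro g hg
    refine Measurable.ennreal_induction (fun c s hs => ?_) (fun f g hd hf hg ihf ihg => ?_)
      (fun f hf hmono ih => ?_) hg
    · simp_rw [lintegral_indicator_const hs]
      exact ⟨(h s hs).1.const_mul c, by rw [lintegral_const_mul'' _ (h s hs).1, (h s hs).2]⟩
    · simp_rw [Pi.add_apply, lintegral_add_left hf]
      exact ⟨ihf.1.add ihg.1, by rw [lintegral_add_left' ihf.1, ihf.2, ihg.2]⟩
    · simp_rw [lintegral_iSup hf hmono]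
      refine ⟨AEMeasurable.iSup fun n => (ih n).1, ?_⟩
      rw [lintegral_iSup' (fun n => (ih n).1)
        (ae_of_all _ fun z m n hmn => lintegral_mono fun x => hmono hmn x)]
      exact iSup_congr fun n => (ih n).2
  -- By invariance, a `μ`-null set is `κ z`-null for almost every `z`.
  have hnull : ∀ᵐ z ∂μ, f =ᵐ[κ z] hf.mk f := by
    obtain ⟨N, hN, hNm, hN0⟩ := exists_measurable_superset_of_null (ae_iff.1 hf.ae_eq_mk)
    have h0 := (h N hNm).2
    rw [hN0, lintegral_eq_zero_iff' (h N hNm).1] at h0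
    filter_upwards [h0] with z hz
    exact ae_iff.2 (measure_mono_null hN hz)
  have heq : (fun z => ∫⁻ x, f x ∂κ z) =ᵐ[μ] fun z => ∫⁻ x, hf.mk f x ∂κ z := by
    filter_upwards [hnull] with z hz using lintegral_congr_ae hz
  refine ⟨(hmeas _ hf.measurable_mk).1.congr heq.symm, ?_⟩
  rw [lintegral_congr_ae heq, (hmeas _ hf.measurable_mk).2, lintegral_congr_ae hf.ae_eq_mk]

/-- An invariant family of subprobability measures contracts `L²`. -/
theorem memLp_two_integral_and_eLpNorm_le {X : Type*} [MeasurableSpace X]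
    {κ : X → Measure X} {μ : Measure X} (hκ : ∀ z, κ z Set.univ ≤ 1)
    (h : ∀ A, MeasurableSet A → AEMeasurable (fun z => κ z A) μ ∧ ∫⁻ z, κ z A ∂μ = μ A)
    {φ : X → ℝ} (hint : ∀ z, Integrable φ (κ z)) (hφ : MemLp φ 2 μ) :
    MemLp (fun z => ∫ x, φ x ∂κ z) 2 μ ∧ eLpNorm (fun z => ∫ x, φ x ∂κ z) 2 μ ≤ eLpNorm φ 2 μ := by
  have hm : AEStronglyMeasurable (fun z => ∫ x, φ x ∂κ z) μ := by
    simp_rw [fun z => integral_eq_lintegral_pos_part_sub_lintegral_neg_part (hint z)]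
    have hp := (aemeasurable_and_lintegral_lintegral_eq h hφ.1.aemeasurable.ennreal_ofReal).1
    have hn := (aemeasurable_and_lintegral_lintegral_eq h hφ.1.aemeasurable.neg.ennreal_ofReal).1
    exact (hp.ennreal_toReal.sub hn.ennreal_toReal).aestronglyMeasurable
  have hsq : ∀ (ν : Measure X) (f : X → ℝ), eLpNorm f 2 ν ^ (2 : ℝ) = ∫⁻ x, ‖f x‖ₑ ^ (2 : ℝ) ∂ν :=
    fun ν f => by
      simpa using eLpNorm_nnreal_pow_eq_lintegral (f := f) (μ := ν) (p := 2) (by norm_num)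
  have hle : eLpNorm (fun z => ∫ x, φ x ∂κ z) 2 μ ≤ eLpNorm φ 2 μ := by
    rw [← ENNReal.rpow_le_rpow_iff (z := 2) (by norm_num), hsq, hsq,
      ← (aemeasurable_and_lintegral_lintegral_eq h (hφ.1.enorm.pow_const (2 : ℝ))).2]
    refine lintegral_mono fun z => ?_
    rw [← hsq]
    gcongr
    -- Cauchy–Schwarz against the constant 1; the extra factor is a power of the mass of `κ z`,
    -- hence at most one.
    calc ‖∫ x, φ x ∂κ z‖ₑ ≤ eLpNorm φ 1 (κ z) := by
          rw [eLpNorm_one_eq_lintegral_enorm]; exact enorm_integral_le_lintegral_enorm φ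
      _ ≤ eLpNorm φ 2 (κ z) * κ z Set.univ ^ (1 / (1 : ℝ≥0∞).toReal - 1 / (2 : ℝ≥0∞).toReal) :=
          eLpNorm_le_eLpNorm_mul_rpow_measure_univ (by norm_num) (hint z).1
      _ ≤ eLpNorm φ 2 (κ z) * 1 := by
          gcongr
          exact ENNReal.rpow_le_one (hκ z) (by norm_num)
      _ = eLpNorm φ 2 (κ z) := mul_one _
  exact ⟨⟨hm, hle.trans_lt hφ.2⟩, hle⟩

end Kernel

/-! ### The Koopman operator as integration over preimages -/

namespace HolomorphicCorrespondence

variable {k : ℕ} {X : Type*} [TopologicalSpace X] [ChartedSpace (CModel k) X]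

theorem finite_fiber (F : HolomorphicCorrespondence k X) (j : Fin F.N) (z : X) :
    {w | (w, z) ∈ F.Γ j}.Finite :=
  (F.finite_preimage z).subset fun w hw => Set.mem_iUnion.2 ⟨j, (w, z), ⟨rfl, hw⟩, rfl⟩

/-- Preimages counted with multiplicity never exceed the topological degree. -/
theorem sum_localDegree_le_topDegree [T2Space X] (F : HolomorphicCorrespondence k X)
    (hd : 0 < F.topDegree) (z : X) :
    ∑ j, F.m j * ∑ w ∈ (F.finite_fiber j z).toFinset, localDegree (F.Γ j) w z ≤ F.topDegree := by
  obtain ⟨G, hGo, hGd, hG⟩ := Nat.sInf_mem (Nat.nonempty_of_pos_sInf hd)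
  have hgen : GenericallyNear z fun z' => z' ∈ G :=
    ⟨Set.univ, univ_mem, G, hGo, hGd, fun z' hz' => hz'.2⟩
  obtain ⟨z', hz', hzG⟩ := ((genericallyNear_forall_finset Finset.univ fun j _ =>
    genericallyNear_sum_localDegree_le (F.finite_fiber j)
      (F.finite_fiber j z).toFinset z).and hgen).exists
  calc _ ≤ ∑ j, F.m j * {w | (w, z') ∈ F.Γ j}.ncard :=
        Finset.sum_le_sum fun j hj => Nat.mul_le_mul_left _ (hz' j hj)
    _ = F.topDegree := hG z' hzG

variable [MeasurableSpace X]

/-- The normalized sum of point masses at the preimages of `z`. -/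
noncomputable def preimageMeasure (F : HolomorphicCorrespondence k X) (z : X) : Measure X :=
  ∑ j, ∑ w ∈ (F.finite_fiber j z).toFinset,
    ((F.m j * localDegree (F.Γ j) w z : ℝ≥0) / F.topDegree) • Measure.dirac w

theorem preimageMeasure_univ_le_one [T2Space X] (F : HolomorphicCorrespondence k X) (z : X) :
    F.preimageMeasure z Set.univ ≤ 1 := by
  have h : F.preimageMeasure z Set.univ = ((∑ j, ∑ w ∈ (F.finite_fiber j z).toFinset,
      (F.m j * localDegree (F.Γ j) w z : ℝ≥0) / F.topDegree : ℝ≥0) : ℝ≥0∞) := by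
    simp [preimageMeasure, Measure.finsetSum_apply]
  rw [h, ENNReal.coe_le_one_iff]
  simp_rw [← Finset.sum_div, ← Finset.mul_sum]
  -- For degree `0`, division by zero makes all weights vanish.
  rcases Nat.eq_zero_or_pos F.topDegree with hd | hd
  · simp [hd]
  · rw [div_le_one (by exact_mod_cast hd)]
    exact_mod_cast F.sum_localDegree_le_topDegree hd z

theorem IsPullbackInvariant.integral_koopman {μ : Measure X}
    {F : HolomorphicCorrespondence k X} (hμ : F.IsPullbackInvariant μ)
    (hd : 0 < F.topDegree) (φ : C(X, ℝ)) : ∫ z, F.koopman φ z ∂μ = ∫ z, φ z ∂μ := by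
  simp_rw [koopman]
  rw [integral_const_mul, hμ φ]
  have : (F.topDegree : ℝ) ≠ 0 := by exact_mod_cast hd.ne'
  field_simp

variable [MeasurableSingletonClass X]

theorem integrable_preimageMeasure (F : HolomorphicCorrespondence k X) (φ : X → ℝ) (z : X) :
    Integrable φ (F.preimageMeasure z) :=
  integrable_finsetSum_measure.2 fun _ _ => integrable_finsetSum_measure.2 fun _ _ =>
    (integrable_dirac (by simp)).smul_measure_nnreal

theorem koopman_eq_integral (F : HolomorphicCorrespondence k X) (φ : X → ℝ) (z : X) :
    F.koopman φ z = ∫ w, φ w ∂F.preimageMeasure z := by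
  rw [preimageMeasure, integral_finsetSum_measure fun j _ =>
    integrable_finsetSum_measure.2 fun _ _ => (integrable_dirac (by simp)).smul_measure_nnreal]
  rw [koopman, preimageSum, Finset.mul_sum]
  refine Finset.sum_congr rfl fun j _ => ?_
  rw [integral_finsetSum_measure fun w _ => (integrable_dirac (by simp)).smul_measure_nnreal,
    finsum_mem_eq_finite_toFinset_sum _ (F.finite_fiber j z), Finset.mul_sum, Finset.mul_sum]
  refine Finset.sum_congr rfl fun w _ => ?_
  rw [integral_smul_nnreal_measure, integral_dirac, NNReal.smul_def]
  push_cast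
  rw [smul_eq_mul]
  ring

theorem iterate_koopman_sub (F : HolomorphicCorrespondence k X) (φ φ' : X → ℝ) (n : ℕ) :
    F.koopman^[n] (φ - φ') = F.koopman^[n] φ - F.koopman^[n] φ' := by
  induction n generalizing φ φ' with
  | zero => rfl
  | succ n ih =>
    have h : F.koopman (φ - φ') = F.koopman φ - F.koopman φ' := by
      ext z
      simp only [Pi.sub_apply, koopman_eq_integral]
      exact integral_sub (F.integrable_preimageMeasure φ z) (F.integrable_preimageMeasure φ' z)
    simp only [Function.iterate_succ_apply, h, ih]

theorem abs_iterate_koopman_le [T2Space X] (F : HolomorphicCorrespondence k X) {φ : X → ℝ} {C : ℝ}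
    (hφ : ∀ z, |φ z| ≤ C) (n : ℕ) (z : X) : |(F.koopman^[n] φ) z| ≤ C := by
  induction n generalizing φ with
  | zero => exact hφ z
  | succ n ih =>
    refine ih fun z => ?_
    have hC : 0 ≤ C := (abs_nonneg _).trans (hφ z)
    have hfin : IsFiniteMeasure (F.preimageMeasure z) :=
      ⟨(F.preimageMeasure_univ_le_one z).trans_lt ENNReal.one_lt_top⟩
    rw [koopman_eq_integral]
    calc |∫ w, φ w ∂F.preimageMeasure z| ≤ C * (F.preimageMeasure z).real Set.univ :=
          norm_integral_le_of_norm_le_const (f := φ) (μ := F.preimageMeasure z) (ae_of_all _ hφ)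
      _ ≤ C * 1 := by
          gcongr
          exact ENNReal.toReal_le_of_le_ofReal zero_le_one
            (by simpa using F.preimageMeasure_univ_le_one z)
      _ = C := mul_one C

section Invariant

variable {μ : Measure X} {F : HolomorphicCorrespondence k X}

/-- Invariance makes `U_F φ` integrable: this is clear for functions of positive integral, and
every continuous function on a compact space is a difference of two of these. -/
theorem IsPullbackInvariant.integrable_koopman [CompactSpace X] [OpensMeasurableSpace X]
    [IsProbabilityMeasure μ] (hμ : F.IsPullbackInvariant μ) (hd : 0 < F.topDegree)
    (φ : C(X, ℝ)) : Integrable (F.koopman φ) μ := by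
  have hpos : ∀ φ : C(X, ℝ), 0 < ∫ z, φ z ∂μ → Integrable (F.koopman φ) μ := by
    intro φ hφ
    by_contra h
    -- A non-integrable function has integral `0` by convention, which contradicts positivity.
    rw [← hμ.integral_koopman hd φ, integral_undef h] at hφ
    exact hφ.false
  have hone : ∀ c : ℝ, 0 < c → Integrable (F.koopman fun _ => c) μ := fun c hc =>
    hpos (ContinuousMap.const X c) (by simpa using hc)
  have hadd : Integrable (F.koopman fun z => φ z + (‖φ‖ + 1)) μ := by
    refine hpos (φ + ContinuousMap.const X (‖φ‖ + 1)) ?_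
    have h1 : (1 : ℝ) = ∫ _, (1 : ℝ) ∂μ := by simp
    refine one_pos.trans_le (h1.trans_le (integral_mono (integrable_const _) ?_ fun z => ?_))
    · exact (map_continuous _).integrable_of_hasCompactSupport (HasCompactSupport.of_compactSpace _)
    · have := (abs_le.1 (φ.norm_coe_le_norm z)).1
      simp only [ContinuousMap.add_apply, ContinuousMap.const_apply]
      linarith
  have heq : F.koopman φ =
      F.koopman (fun z => φ z + (‖φ‖ + 1)) - F.koopman (fun _ => ‖φ‖ + 1) := by
    have := F.iterate_koopman_sub (fun z => φ z + (‖φ‖ + 1)) (fun _ => ‖φ‖ + 1) 1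
    simp only [Function.iterate_one] at this
    rw [← this]
    congr 1
    ext z
    simp
  rw [heq]
  exact hadd.sub (hone _ (by positivity))

/-- Invariance, tested against measurable sets. -/
theorem IsPullbackInvariant.lintegral_preimageMeasure [T2Space X] [CompactSpace X]
    [TopologicalSpace.PseudoMetrizableSpace X] [BorelSpace X]
    [IsProbabilityMeasure μ] (hμ : F.IsPullbackInvariant μ) (hd : 0 < F.topDegree)
    (A : Set X) (hA : MeasurableSet A) :
    AEMeasurable (fun z => F.preimageMeasure z A) μ ∧ ∫⁻ z, F.preimageMeasure z A ∂μ = μ A := by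
  refine aemeasurable_and_lintegral_measure_eq F.preimageMeasure_univ_le_one (fun g => ?_) hA
  let φ : C(X, ℝ) := ⟨fun x => g x, NNReal.continuous_coe.comp g.continuous⟩
  have hφ : ∀ x, φ x = g x := fun _ => rfl
  have hof : ∀ ν : Measure X, Integrable φ ν →
      ∫⁻ x, g x ∂ν = ENNReal.ofReal (∫ x, φ x ∂ν) := fun ν hν => by
    rw [ofReal_integral_eq_lintegral_ofReal hν (ae_of_all _ fun x => NNReal.coe_nonneg _)]
    simp [hφ]
  have hκ : ∀ z, ∫⁻ x, g x ∂F.preimageMeasure z = ENNReal.ofReal (F.koopman φ z) := fun z => by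
    rw [hof _ (F.integrable_preimageMeasure φ z), koopman_eq_integral]
  have hint := hμ.integrable_koopman hd φ
  simp_rw [hκ]
  refine ⟨hint.1.aemeasurable.ennreal_ofReal, ?_⟩
  rw [hof μ ((map_continuous φ).integrable_of_hasCompactSupport
    (HasCompactSupport.of_compactSpace _)), ← hμ.integral_koopman hd φ,
    ofReal_integral_eq_lintegral_ofReal hint (ae_of_all _ fun z => ?_)]
  rw [koopman_eq_integral]
  exact integral_nonneg fun x => NNReal.coe_nonneg _

theorem IsPullbackInvariant.memLp_iterate_koopman [T2Space X] [CompactSpace X]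
    [TopologicalSpace.PseudoMetrizableSpace X] [BorelSpace X]
    [IsProbabilityMeasure μ] (hμ : F.IsPullbackInvariant μ) {φ : X → ℝ} (hφ : MemLp φ 2 μ)
    (n : ℕ) : MemLp (F.koopman^[n] φ) 2 μ ∧ eLpNorm (F.koopman^[n] φ) 2 μ ≤ eLpNorm φ 2 μ := by
  induction n generalizing φ with
  | zero => exact ⟨hφ, le_rfl⟩
  | succ n ih =>
    have h : MemLp (F.koopman φ) 2 μ ∧ eLpNorm (F.koopman φ) 2 μ ≤ eLpNorm φ 2 μ := by
      rcases Nat.eq_zero_or_pos F.topDegree with hd | hd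
      · have h0 : F.koopman φ = 0 := by ext z; simp [koopman, hd]
        simp [h0]
      · have h1 : F.koopman φ = fun z => ∫ w, φ w ∂F.preimageMeasure z :=
          funext (F.koopman_eq_integral φ)
        rw [h1]
        exact memLp_two_integral_and_eLpNorm_le F.preimageMeasure_univ_le_one
          (hμ.lintegral_preimageMeasure hd) (F.integrable_preimageMeasure φ) hφ
    exact ⟨(ih h.1).1, (ih h.1).2.trans h.2⟩

end Invariant

end HolomorphicCorrespondence

/-! ### Integral bounds and stable modes of convergence -/

theorem abs_integral_mul_le_eLpNorm_two {X : Type*} [MeasurableSpace X] {μ : Measure X}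
    {f g : X → ℝ} (hf : MemLp f 2 μ) (hg : MemLp g 2 μ) :
    |∫ z, f z * g z ∂μ| ≤ (eLpNorm f 2 μ).toReal * (eLpNorm g 2 μ).toReal := by
  rw [← ENNReal.toReal_mul, ← Real.norm_eq_abs, ← toReal_enorm]
  refine ENNReal.toReal_mono (ENNReal.mul_ne_top hf.2.ne hg.2.ne) ?_
  have h := eLpNorm_smul_le_mul_eLpNorm (p := 2) (q := 2) (r := 1) hg.1 hf.1
  rw [eLpNorm_one_eq_lintegral_enorm] at h
  exact (enorm_integral_le_lintegral_enorm _).trans h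

theorem abs_integral_le_eLpNorm_two {X : Type*} [MeasurableSpace X] {μ : Measure X}
    [IsProbabilityMeasure μ] {f : X → ℝ} (hf : MemLp f 2 μ) :
    |∫ z, f z ∂μ| ≤ (eLpNorm f 2 μ).toReal := by
  have h1 : eLpNorm (fun _ : X => (1 : ℝ)) 2 μ = 1 := by
    simp [eLpNorm_const _ two_ne_zero (IsProbabilityMeasure.ne_zero μ)]
  simpa [h1] using abs_integral_mul_le_eLpNorm_two hf (memLp_const (1 : ℝ))

/-- A mode of convergence to zero that is stable under uniform approximation. -/
def StableUnderUniformApprox (T : (ℕ → ℝ) → Prop) : Prop :=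
  ∀ a : ℕ → ℝ, (∀ ε > 0, ∃ b, T b ∧ ∀ n, |a n - b n| ≤ ε) → T a

theorem stableUnderUniformApprox_tendsto :
    StableUnderUniformApprox fun a => Tendsto a atTop (𝓝 0) := by
  intro a h
  rw [Metric.tendsto_atTop]
  intro ε hε
  obtain ⟨b, hb, hab⟩ := h (ε / 2) (half_pos hε)
  obtain ⟨N, hN⟩ := Metric.tendsto_atTop.1 hb (ε / 2) (half_pos hε)
  refine ⟨N, fun n hn => ?_⟩
  have h1 := hN n hn
  rw [Real.dist_0_eq_abs] at h1 ⊢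
  have h2 := abs_add_le (a n - b n) (b n)
  rw [sub_add_cancel] at h2
  linarith [hab n]

/-- Averaging absolute values does not increase uniform distance, which reduces this to ordinary
convergence. -/
theorem stableUnderUniformApprox_tendsto_average : StableUnderUniformApprox fun a =>
    Tendsto (fun n : ℕ => (1 / (n : ℝ)) * ∑ j ∈ Finset.range n, |a j|) atTop (𝓝 0) := by
  intro a h
  refine stableUnderUniformApprox_tendsto _ fun ε hε => ?_
  obtain ⟨b, hb, hab⟩ := h ε hε
  refine ⟨_, hb, fun n => ?_⟩
  rw [← mul_sub, ← Finset.sum_sub_distrib, abs_mul, abs_of_nonneg (by positivity)]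
  have h1 : |∑ j ∈ Finset.range n, (|a j| - |b j|)| ≤ n * ε := by
    refine (Finset.abs_sum_le_sum_abs _ _).trans ?_
    simpa using Finset.sum_le_card_nsmul (Finset.range n) _ ε fun j _ =>
      (abs_abs_sub_abs_le_abs_sub (a j) (b j)).trans (hab j)
  rcases Nat.eq_zero_or_pos n with hn | hn
  · simp [hn, hε.le]
  · have hn' : (0 : ℝ) < n := by exact_mod_cast hn
    calc _ ≤ 1 / (n : ℝ) * (n * ε) := by gcongr
      _ = ε := by field_simp

/-! ### Uniform estimates for the deviation from independence -/

namespace HolomorphicCorrespondence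

variable {k : ℕ} {X : Type*} [TopologicalSpace X] [ChartedSpace (CModel k) X]
  [MeasurableSpace X]

/-- The deviation `I_n^F(φ, ψ) - I(φ) I(ψ)` from independence. -/
noncomputable def deviation (F : HolomorphicCorrespondence k X) (μ : Measure X) (φ ψ : X → ℝ)
    (n : ℕ) : ℝ :=
  F.correlation μ n φ ψ - (∫ z, φ z ∂μ) * ∫ z, ψ z ∂μ

variable [T2Space X] [CompactSpace X] [TopologicalSpace.PseudoMetrizableSpace X] [BorelSpace X]
  {F : HolomorphicCorrespondence k X} {μ : Measure X} [IsProbabilityMeasure μ]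

/-- Each of the two terms of the deviation contributes one product of `L²` norms, the correlation by
contraction of `U_F`; the bound is free of `n`. -/
theorem IsPullbackInvariant.abs_deviation_sub_left_le (hμ : F.IsPullbackInvariant μ)
    {φ φ' ψ : X → ℝ} (hφ : MemLp φ 2 μ) (hφ' : MemLp φ' 2 μ) (hψ : MemLp ψ 2 μ) (n : ℕ) :
    |F.deviation μ φ ψ n - F.deviation μ φ' ψ n| ≤
      2 * (eLpNorm (φ - φ') 2 μ).toReal * (eLpNorm ψ 2 μ).toReal := by
  have hs := hμ.memLp_iterate_koopman (hφ.sub hφ') n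
  have heq : F.deviation μ φ ψ n - F.deviation μ φ' ψ n =
      ∫ z, (F.koopman^[n] (φ - φ')) z * ψ z ∂μ - (∫ z, (φ - φ') z ∂μ) * ∫ z, ψ z ∂μ := by
    have hint : ∀ f : X → ℝ, MemLp f 2 μ → Integrable (fun z => (F.koopman^[n] f) z * ψ z) μ :=
      fun f hf => (hμ.memLp_iterate_koopman hf n).1.integrable_mul hψ
    simp only [deviation, correlation, iterate_koopman_sub, Pi.sub_apply, sub_mul]
    rw [integral_sub (hint φ hφ) (hint φ' hφ'),
      integral_sub (hφ.integrable one_le_two) (hφ'.integrable one_le_two)]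
    ring
  have h1 := abs_integral_mul_le_eLpNorm_two hs.1 hψ
  have h2 : (eLpNorm (F.koopman^[n] (φ - φ')) 2 μ).toReal ≤ (eLpNorm (φ - φ') 2 μ).toReal :=
    ENNReal.toReal_mono (hφ.sub hφ').2.ne hs.2
  have h3 := mul_le_mul (abs_integral_le_eLpNorm_two (hφ.sub hφ'))
    (abs_integral_le_eLpNorm_two hψ) (abs_nonneg _) ENNReal.toReal_nonneg
  have h4 := mul_le_mul_of_nonneg_right h2 (ENNReal.toReal_nonneg (a := eLpNorm ψ 2 μ))
  rw [heq]
  refine (abs_sub _ _).trans ?_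
  rw [abs_mul]
  linarith

/-- The iterates of `U_F` keep the pointwise bound `C`, so `L¹` control of the second argument is
enough. -/
theorem IsPullbackInvariant.abs_deviation_sub_right_le (hμ : F.IsPullbackInvariant μ)
    {φ ψ ψ' : X → ℝ} {C : ℝ} (hφm : AEStronglyMeasurable φ μ) (hφ : ∀ z, |φ z| ≤ C)
    (hψ : Integrable ψ μ) (hψ' : Integrable ψ' μ) (n : ℕ) :
    |F.deviation μ φ ψ n - F.deviation μ φ ψ' n| ≤ 2 * C * ∫ z, |ψ z - ψ' z| ∂μ := by
  have hK := hμ.memLp_iterate_koopman (MemLp.of_bound hφm C (ae_of_all _ hφ)) n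
  have hb := F.abs_iterate_koopman_le hφ n
  have hint : ∀ f : X → ℝ, Integrable f μ → Integrable (fun z => (F.koopman^[n] φ) z * f z) μ :=
    fun f hf => hf.bdd_mul hK.1.1 (ae_of_all _ hb)
  have heq : F.deviation μ φ ψ n - F.deviation μ φ ψ' n =
      ∫ z, (F.koopman^[n] φ) z * (ψ z - ψ' z) ∂μ -
        (∫ z, φ z ∂μ) * ∫ z, (ψ z - ψ' z) ∂μ := by
    simp only [deviation, correlation, mul_sub]
    rw [integral_sub (hint ψ hψ) (hint ψ' hψ'), integral_sub hψ hψ']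
    ring
  have h1 : |∫ z, (F.koopman^[n] φ) z * (ψ z - ψ' z) ∂μ| ≤ C * ∫ z, |ψ z - ψ' z| ∂μ := by
    rw [← integral_const_mul]
    refine norm_integral_le_of_norm_le (f := fun z => (F.koopman^[n] φ) z * (ψ z - ψ' z))
      ((hψ.sub hψ').abs.const_mul C) (ae_of_all _ fun z => ?_)
    rw [norm_mul]
    exact mul_le_mul_of_nonneg_right (hb z) (abs_nonneg _)
  have h2 : |∫ z, φ z ∂μ| ≤ C := by
    simpa using norm_integral_le_of_norm_le_const (μ := μ) (f := φ) (ae_of_all _ hφ)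
  have h3 := mul_le_mul h2 (norm_integral_le_integral_norm (μ := μ) fun z => ψ z - ψ' z)
    (norm_nonneg _) ((abs_nonneg _).trans h2)
  simp only [Real.norm_eq_abs] at h3
  rw [heq]
  refine (abs_sub _ _).trans ?_
  rw [abs_mul]
  linarith

/-- Convergence of the deviations for continuous against integrable functions is equivalent to
their convergence for square integrable functions. -/
theorem IsPullbackInvariant.forall_continuous_iff_forall_memLp_two
    (hμ : F.IsPullbackInvariant μ) {T : (ℕ → ℝ) → Prop} (hT : StableUnderUniformApprox T) :
    (∀ (φ : C(X, ℝ)) (ψ : X → ℝ), Integrable ψ μ → T (F.deviation μ φ ψ)) ↔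
      ∀ φ ψ : X → ℝ, MemLp φ 2 μ → MemLp ψ 2 μ → T (F.deviation μ φ ψ) := by
  constructor
  · intro h φ ψ hφ hψ
    refine hT _ fun ε hε => ?_
    set M := (eLpNorm ψ 2 μ).toReal
    have hM : 0 ≤ M := ENNReal.toReal_nonneg
    -- `M + 1` instead of `M` avoids dividing by zero when `ψ` vanishes almost everywhere.
    have hδ : 0 < ε / (2 * (M + 1)) := by positivity
    obtain ⟨g, hg, hgm⟩ := hφ.exists_boundedContinuous_eLpNorm_sub_le ENNReal.ofNat_ne_top
      (ENNReal.ofReal_pos.2 hδ).ne'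
    refine ⟨_, h g.toContinuousMap ψ (hψ.integrable one_le_two), fun n => ?_⟩
    refine (hμ.abs_deviation_sub_left_le hφ hgm hψ n).trans ?_
    have h1 : (eLpNorm (φ - ⇑g) 2 μ).toReal ≤ ε / (2 * (M + 1)) :=
      ENNReal.toReal_le_of_le_ofReal hδ.le hg
    calc 2 * (eLpNorm (φ - ⇑g) 2 μ).toReal * M ≤ 2 * (ε / (2 * (M + 1))) * (M + 1) := by
          gcongr
          linarith
      _ = ε := by field_simp
  · intro h φ ψ hψ
    refine hT _ fun ε hε => ?_
    have hδ : 0 < ε / (2 * (‖φ‖ + 1)) := by positivity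
    obtain ⟨g, hg, hgi⟩ := hψ.exists_boundedContinuous_integral_sub_le hδ
    have hφm : AEStronglyMeasurable φ μ := (map_continuous φ).aestronglyMeasurable
    have hgm : MemLp g 2 μ := MemLp.of_bound hgi.1 ‖g‖ (ae_of_all _ g.norm_coe_le_norm)
    refine ⟨_, h φ g (MemLp.of_bound hφm ‖φ‖ (ae_of_all _ φ.norm_coe_le_norm)) hgm, fun n => ?_⟩
    refine (hμ.abs_deviation_sub_right_le hφm φ.norm_coe_le_norm hψ hgi n).trans ?_
    calc 2 * ‖φ‖ * ∫ z, |ψ z - g z| ∂μ ≤ 2 * (‖φ‖ + 1) * (ε / (2 * (‖φ‖ + 1))) := by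
          gcongr
          · linarith
          · exact hg
      _ = ε := by field_simp

end HolomorphicCorrespondence

theorem theorem4 {k : ℕ} {X : Type*} [TopologicalSpace X] [T2Space X] [CompactSpace X]
    [ConnectedSpace X] [ChartedSpace (CModel k) X] [IsManifold 𝓘(ℂ, CModel k) ω X]
    [MeasurableSpace X] [BorelSpace X]
    (F : HolomorphicCorrespondence k X) (μ : Measure X) [IsProbabilityMeasure μ]
    (hμ : F.IsPullbackInvariant μ) :
    (F.IsMixing μ ↔
      ∀ φ ψ : X → ℝ, MemLp φ 2 μ → MemLp ψ 2 μ →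
        Tendsto (fun n : ℕ => F.correlation μ n φ ψ) atTop
          (𝓝 ((∫ z, φ z ∂μ) * ∫ z, ψ z ∂μ))) ∧
    (F.IsWeaklyMixing μ ↔
      ∀ φ ψ : X → ℝ, MemLp φ 2 μ → MemLp ψ 2 μ →
        Tendsto (fun n : ℕ => (1 / (n : ℝ)) * ∑ j ∈ Finset.range n,
          |F.correlation μ j φ ψ - (∫ z, φ z ∂μ) * ∫ z, ψ z ∂μ|) atTop (𝓝 0)) := by
  -- A compact Hausdorff manifold is metrizable, which supplies continuous approximations of
  -- indicators of closed sets and of `Lᵖ` functions.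
  have : SecondCountableTopology X := ChartedSpace.secondCountable_of_sigmaCompact (CModel k) X
  have : TopologicalSpace.MetrizableSpace X :=
    TopologicalSpace.metrizableSpace_of_t3_secondCountable X
  refine ⟨?_, hμ.forall_continuous_iff_forall_memLp_two stableUnderUniformApprox_tendsto_average⟩
  have h := hμ.forall_continuous_iff_forall_memLp_two stableUnderUniformApprox_tendsto
  unfold HolomorphicCorrespondence.deviation at h
  simp_rw [tendsto_sub_nhds_zero_iff] at h
  exact h
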